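/- Let $(\Sigma,\mu)$ be a $\sigma$-finite measure space, $1\le q<\infty$, $1\le r\le\infty$, $\omega\ge 0$, $\varrho\ge 0$, $\sigma>0$, $C>0$, and let all $L^p=L^p(\Sigma,\mu)$ be spaces of real-valued functions. An operator on $L^q$ is a subset $A\subseteq L^q\times L^q$; its domain is $D(A)=\{u:\ (u,v)\in A\text{ for some }v\}$, and $\overline{D(A)}$ is the closure of $D(A)$ in $L^q$. For $u,v\in L^q$ let $$[u,v]_q=\lim_{\lambda\to0+}\frac{\tfrac1q\|u+\lambda v\|_q^q-\tfrac1q\|u\|_q^q}{\lambda}.$$ Let $A$ be an operator on $L^q$ with the following three properties. (i) $A+\omega I=\{(u,v+\omega u):(u,v)\in A\}$ is $m$-accretive in $L^q$. That is, $\|u-\hat u\|_q\le\|u-\hat u+\lambda(w-\hat w)\|_q$ for all $(u,w),(\hat u,\hat w)\in A+\omega I$ and all $\lambda\ge0$, and for some $\lambda>0$ every $f\in L^q$ is of the form $f=u+\lambda w$ with $(u,w)\in A+\omega I$. (ii) $A$ satisfies the $L^q$-$L^r$-Gagliardo–Nirenberg type inequality with differences: for all $(u,v),(\hat u,\hat v)\in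 A$ one has $u-\hat u\in L^r$ and $$\|u-\hat u\|_r^{\sigma}\le C\Big([u-\hat u,v-\hat v]_q+\omega\|u-\hat u\|_q^q\Big)\|u-\hat u\|_q^{\varrho}.$$ (iii) The semigroup $\{T_t\}_{t\ge0}$ generated by $-A$ on $\overline{D(A)}$, that is, $T_tu=\lim_{n\to\infty}(I+\tfrac tnA)^{-n}u$ in $L^q$ for $t>0$ and $T_0u=u$, has exponential growth in $L^r$: for all $t>0$ and all $u,\hat u\in\overline{D(A)}$ with $u-\hat u\in L^r$ one has $T_tu-T_t\hat u\in L^r$ and $\|T_tu-T_t\hat u\|_r\le e^{\omega t}\|u-\hat u\|_r$. Then for every $t>0$ and all $u,\hat u\in\overline{D(A)}$ one has $T_tu-T_t\hat u\in L^r$ and $$\|T_tu-T_t\hat u\|_r\le\Big(\frac Cq\Big)^{1/\sigma}\,t^{-1/\sigma}\,e^{\omega(\gamma+1)t}\,\|u-\hat u\|_q^{\gamma},\qquad \gamma=\frac{q+\varrho}{\sigma}.$$ -/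

import Mathlib

open MeasureTheory Filter Topology Set
open scoped ENNReal

/-! Multivalued operators on a real normed space `X` are identified with their graphs, that is,
with subsets of `X × X`. -/

/-- The effective domain `D(A)` of an operator `A`. -/
def opDomain {X : Type*} (A : Set (X × X)) : Set X :=
  {u | ∃ v, (u, v) ∈ A}

/-- The operator `A + ω I`. -/
def opShift {X : Type*} [NormedAddCommGroup X] [NormedSpace ℝ X]
    (A : Set (X × X)) (ω : ℝ) : Set (X × X) :=
  {p | ∃ v, (p.1, v) ∈ A ∧ p.2 = v + ω • p.1}

/-- Accretivity: `‖u - û‖ ≤ ‖u - û + lam (v - v̂)‖` for all `(u, v), (û, v̂) ∈ A`, `lam ≥ 0`. -/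
def IsAccretive {X : Type*} [NormedAddCommGroup X] [NormedSpace ℝ X]
    (A : Set (X × X)) : Prop :=
  ∀ p ∈ A, ∀ p' ∈ A, ∀ lam : ℝ, 0 ≤ lam →
    ‖p.1 - p'.1‖ ≤ ‖p.1 - p'.1 + lam • (p.2 - p'.2)‖

/-- m-accretivity: accretivity together with the range condition `Rg (I + lam A) = X` for some
`lam > 0`. -/
def IsMAccretive {X : Type*} [NormedAddCommGroup X] [NormedSpace ℝ X]
    (A : Set (X × X)) : Prop :=
  IsAccretive A ∧ ∃ lam : ℝ, 0 < lam ∧ ∀ f : X, ∃ p ∈ A, p.1 + lam • p.2 = f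

open Classical in
/-- The resolvent `J_lam = (I + lam A)⁻¹`: `opResolvent A lam f` is a solution `u` of
`u + lam A u ∋ f`. If `A + ω I` is m-accretive, `lam > 0` and `lam ω < 1`, then this solution exists
and is unique for every `f`; if there is no solution, the value is `0`. -/
noncomputable def opResolvent {X : Type*} [NormedAddCommGroup X] [NormedSpace ℝ X]
    (A : Set (X × X)) (lam : ℝ) (f : X) : X :=
  if h : ∃ u, ∃ v, (u, v) ∈ A ∧ u + lam • v = f then h.choose else 0

/-- The semigroup `{T_t}_{t ≥ 0}` generated by `-A` on the closure of `D(A)`, given by the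
exponential formula `T_t u = lim_{n → ∞} (I + (t / n) A)⁻ⁿ u` for `t > 0`, and `T_0 u = u`.
If `A + ω I` is m-accretive in a Banach space, the limit exists for every `u` in the closure of
`D(A)`. -/
noncomputable def opSemigroup {X : Type*} [NormedAddCommGroup X] [NormedSpace ℝ X]
    (A : Set (X × X)) (t : ℝ) (u : X) : X :=
  if 0 < t then limUnder atTop (fun n : ℕ => (opResolvent A (t / n))^[n] u) else u

/-- The `q`-bracket `[u, v]_q` on `L^q`, `1 ≤ q < ∞`: the right-hand derivative at `0` of
`lam ↦ (1 / q) ‖u + lam v‖_q ^ q`. -/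
noncomputable def qBracket {S : Type*} [MeasurableSpace S] {μ : Measure S} {q : ℝ≥0∞}
    [Fact (1 ≤ q)] (u v : Lp ℝ q μ) : ℝ :=
  derivWithin (fun lam : ℝ => (1 / q.toReal) * ‖u + lam • v‖ ^ q.toReal) (Ioi 0) 0

/-- The `q`-bracket is a genuine limit of difference quotients. -/
theorem tendsto_qBracket {S : Type*} [MeasurableSpace S] {μ : Measure S} {q : ℝ≥0∞}
    [Fact (1 ≤ q)] (hq : q ≠ ∞) (u v : Lp ℝ q μ) :
    Tendsto (fun lam : ℝ => ((1 / q.toReal) * ‖u + lam • v‖ ^ q.toReal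
      - (1 / q.toReal) * ‖u‖ ^ q.toReal) / lam) (𝓝[>] 0) (𝓝 (qBracket u v)) := by
  have hq1 : (1 : ℝ) ≤ q.toReal := by
    have h := ENNReal.toReal_mono hq (Fact.out : (1 : ℝ≥0∞) ≤ q)
    simpa using h
  have h1 : ConvexOn ℝ univ (fun lam : ℝ => ‖u + lam • v‖) := by
    refine ⟨convex_univ, fun x _ y _ a b ha hb hab => ?_⟩
    have e : u + (a • x + b • y) • v = a • (u + x • v) + b • (u + y • v) := by
      have : u = (a + b) • u := by rw [hab, one_smul]
      nth_rewrite 1 [this]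
      simp only [smul_eq_mul]
      module
    simp only [smul_eq_mul] at *
    rw [e]
    refine (norm_add_le _ _).trans (le_of_eq ?_)
    rw [norm_smul, norm_smul, Real.norm_of_nonneg ha, Real.norm_of_nonneg hb]
  have h2 : ConvexOn ℝ univ (fun lam : ℝ => (1 / q.toReal) * ‖u + lam • v‖ ^ q.toReal) := by
    refine ⟨convex_univ, fun x _ y _ a b ha hb hab => ?_⟩
    have h3 := h1.2 (mem_univ x) (mem_univ y) ha hb hab
    have h4 := (convexOn_rpow hq1).2 (show ‖u + x • v‖ ∈ Ici (0 : ℝ) from norm_nonneg _)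
      (show ‖u + y • v‖ ∈ Ici (0 : ℝ) from norm_nonneg _) ha hb hab
    have h5 := Real.rpow_le_rpow (norm_nonneg _) h3 (by linarith : 0 ≤ q.toReal)
    have h6 := mul_le_mul_of_nonneg_left (h5.trans h4)
      (by positivity : 0 ≤ 1 / q.toReal)
    refine h6.trans (le_of_eq ?_)
    simp only [smul_eq_mul]
    ring
  have hd := (h2.differentiableWithinAt_Ioi_of_mem_interior
    (x := 0) (by simp)).hasDerivWithinAt
  rw [hasDerivWithinAt_iff_tendsto_slope' (by simp)] at hd
  refine hd.congr fun x => ?_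
  simp [slope_def_field]

/-- The `L^q`-`L^r`-Gagliardo–Nirenberg type inequality with differences with parameters `ϱ`, `σ`,
`ω` and constant `C`. -/
def GagliardoNirenbergWithDifferences {S : Type*} [MeasurableSpace S] {μ : Measure S} {q : ℝ≥0∞}
    [Fact (1 ≤ q)] (A : Set (Lp ℝ q μ × Lp ℝ q μ)) (r : ℝ≥0∞) (ϱ σ ω C : ℝ) : Prop :=
  ∀ p ∈ A, ∀ p' ∈ A,
    MemLp (p.1 - p'.1 : Lp ℝ q μ) r μ ∧
    (eLpNorm (p.1 - p'.1 : Lp ℝ q μ) r μ).toReal ^ σ ≤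
      C * (qBracket (p.1 - p'.1) (p.2 - p'.2) + ω * ‖p.1 - p'.1‖ ^ q.toReal)
        * ‖p.1 - p'.1‖ ^ ϱ

/-- Exponential growth in `L^r` of the semigroup generated by `-A`: for all `u`, `û` in the closure
of `D(A)` with `u - û ∈ L^r` and all `t > 0`, one has `T_t u - T_t û ∈ L^r` and
`‖T_t u - T_t û‖_r ≤ e^{ω t} ‖u - û‖_r`. -/
def HasExponentialGrowth {S : Type*} [MeasurableSpace S] {μ : Measure S} {q : ℝ≥0∞}
    [Fact (1 ≤ q)] (A : Set (Lp ℝ q μ × Lp ℝ q μ)) (r : ℝ≥0∞) (ω : ℝ) : Prop :=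
  ∀ u ∈ closure (opDomain A), ∀ u' ∈ closure (opDomain A), ∀ t : ℝ, 0 < t →
    MemLp (u - u' : Lp ℝ q μ) r μ →
      MemLp (opSemigroup A t u - opSemigroup A t u' : Lp ℝ q μ) r μ ∧
      (eLpNorm (opSemigroup A t u - opSemigroup A t u' : Lp ℝ q μ) r μ).toReal ≤
        Real.exp (ω * t) * (eLpNorm (u - u' : Lp ℝ q μ) r μ).toReal

/-! Trajectories of the semigroup need not be differentiable, so the Gagliardo–Nirenberg inequality
is applied along the implicit Euler scheme with step λ = t/n. Let w_k be the difference of the k-th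
iterates. Convexity (`mul_qBracket_le`) bounds the bracket by a difference quotient, so
λ‖w_{k+1}‖_r^σ is at most C/q times the drop ‖w_k‖_q^q - (1 - λqω)‖w_{k+1}‖_q^q times ‖w_{k+1}‖_q^ϱ.
With geometric weights the drops telescope, hence some k ≤ n has t‖w_k‖_r^σ bounded by a quantity
that tends to (C/q) e^{ω(q+ϱ)t} ‖u - û‖_q^{q+ϱ}.

Growth in L^r is given for the semigroup, not for the resolvents. Therefore the semigroup, not the
Euler scheme, is run from the k-th iterate over the remaining time (n-k)t/n, which costs a factor at
most e^{ωt}. For initial values in the domain, Kobayashi's estimate makes the error small uniformly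
in k, so these hybrids converge in L^q to T_t u. Lower semicontinuity of the L^r norm gives the
bound, and L^q-Lipschitz continuity of T_t extends it to the closure of the domain. -/

/-! ### Resolvents and Kobayashi's estimate -/

section Resolvent

variable {X : Type*} [NormedAddCommGroup X] [NormedSpace ℝ X] {A : Set (X × X)} {ω : ℝ}

/-- Accretivity of `A + ω I` in terms of `A`. -/
theorem IsAccretive.one_sub_mul_norm_le (hA : IsAccretive (opShift A ω)) {u v u' v' : X}
    (h : (u, v) ∈ A) (h' : (u', v') ∈ A) {τ : ℝ} (hτ : 0 ≤ τ) (hτω : τ * ω < 1) :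
    (1 - τ * ω) * ‖u - u'‖ ≤ ‖u - u' + τ • (v - v')‖ := by
  have h1 : 0 < 1 - τ * ω := by linarith
  have key := hA (u, v + ω • u) ⟨v, h, rfl⟩ (u', v' + ω • u') ⟨v', h', rfl⟩
    (τ / (1 - τ * ω)) (by positivity)
  have e : u - u' + (τ / (1 - τ * ω)) • ((v + ω • u) - (v' + ω • u'))
      = (1 - τ * ω)⁻¹ • (u - u' + τ • (v - v')) := by
    have e1 : (v + ω • u) - (v' + ω • u') = (v - v') + ω • (u - u') := by module
    rw [e1, smul_add, smul_smul, smul_add, smul_smul, ← add_assoc, add_right_comm]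
    congr 1
    · have : (1 - τ * ω)⁻¹ = 1 + τ / (1 - τ * ω) * ω := by field_simp; ring
      rw [this, add_smul, one_smul]
    · congr 1
      field_simp
  simp only at key
  rw [e, norm_smul, Real.norm_of_nonneg (by positivity)] at key
  rw [← le_inv_mul_iff₀ h1]
  exact key

/-- The range condition for one parameter carries over to all larger than half of it. -/
theorem IsAccretive.range_of_half_lt [CompleteSpace X] {B : Set (X × X)} (hB : IsAccretive B)
    {lam₀ lam : ℝ} (h₀ : 0 < lam₀) (h : ∀ f : X, ∃ p ∈ B, p.1 + lam₀ • p.2 = f)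
    (hlam : lam₀ / 2 < lam) (f : X) : ∃ p ∈ B, p.1 + lam • p.2 = f := by
  have hl : 0 < lam := by linarith
  choose J hJ hJe using h
  set a : ℝ := lam₀ / lam with ha
  have ha0 : 0 < a := by positivity
  have ha2 : a < 2 := by rw [ha, div_lt_iff₀ hl]; linarith
  have hab : |1 - a| < 1 := by rw [abs_lt]; constructor <;> linarith
  -- A fixed point u of this map solves the equation with parameter `lam`. Its Lipschitz constant |1
  -- - a| is below 1 exactly because `lam` exceeds `lam₀ / 2`.
  let Φ : X → X := fun u => (J (a • f + (1 - a) • u)).1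
  have hΦ : ContractingWith ⟨|1 - a|, abs_nonneg _⟩ Φ := by
    refine ⟨by exact_mod_cast hab, LipschitzWith.of_dist_le_mul fun x y => ?_⟩
    have := hB _ (hJ (a • f + (1 - a) • x)) _ (hJ (a • f + (1 - a) • y)) lam₀ h₀.le
    rw [dist_eq_norm, dist_eq_norm]
    refine this.trans (le_of_eq ?_)
    have e : ∀ p p' : X × X, p.1 - p'.1 + lam₀ • (p.2 - p'.2)
      = (p.1 + lam₀ • p.2) - (p'.1 + lam₀ • p'.2) := fun p p' => by module
    rw [e, hJe, hJe, add_sub_add_left_eq_sub, ← smul_sub, norm_smul]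
    rfl
  have hfix := hΦ.fixedPoint_isFixedPt
  set u := ContractingWith.fixedPoint Φ hΦ
  have hu : (J (a • f + (1 - a) • u)).1 = u := hfix
  refine ⟨_, hJ (a • f + (1 - a) • u), ?_⟩
  have h2 := hJe (a • f + (1 - a) • u)
  rw [hu] at h2 ⊢
  set w := (J (a • f + (1 - a) • u)).2
  have h3 : lam₀ • w = a • (f - u) := by
    have : lam₀ • w = a • f + (1 - a) • u - u := by rw [← h2]; abel
    rw [this]; module
  have h4 : lam • w = f - u := by
    have : lam • w = a⁻¹ • (lam₀ • w) := by
      rw [smul_smul]; congr 1; rw [ha]; field_simp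
    rw [this, h3, smul_smul, inv_mul_cancel₀ ha0.ne', one_smul]
  rw [h4]; abel

/-- The range condition for an m-accretive operator holds for all positive parameters. -/
theorem IsMAccretive.range [CompleteSpace X] {B : Set (X × X)} (hB : IsMAccretive B)
    {lam : ℝ} (hlam : 0 < lam) (f : X) : ∃ p ∈ B, p.1 + lam • p.2 = f := by
  obtain ⟨hacc, lam₀, h₀, h⟩ := hB
  -- Any ratio strictly between 1/2 and 1 would do in place of 2/3.
  have key : ∀ k : ℕ, ∀ f : X, ∃ p ∈ B, p.1 + (lam₀ * (2 / 3) ^ k) • p.2 = f := by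
    intro k
    induction k with
    | zero => simpa using h
    | succ k ih =>
      intro f
      have hp : 0 < lam₀ * (2 / 3 : ℝ) ^ k := by positivity
      exact hacc.range_of_half_lt hp ih (by rw [pow_succ]; linarith) f
  obtain ⟨k, hk⟩ := exists_pow_lt_of_lt_one (show 0 < lam / lam₀ by positivity)
    (show (2 / 3 : ℝ) < 1 by norm_num)
  rw [lt_div_iff₀ h₀] at hk
  have hp : 0 < lam₀ * (2 / 3 : ℝ) ^ k := by positivity
  exact hacc.range_of_half_lt hp (key k) (by linarith) f

/-- Dividing u + lam v = f by 1 - lam ω turns it into the resolvent equation of `A + ω I` with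
parameter lam / (1 - lam ω), where the range condition applies. -/
theorem opResolvent_mem [CompleteSpace X] (hA : IsMAccretive (opShift A ω)) {lam : ℝ}
    (hlam : 0 < lam) (hω : lam * ω < 1) (f : X) :
    (opResolvent A lam f, lam⁻¹ • (f - opResolvent A lam f)) ∈ A := by
  have hex : ∃ u, ∃ v, (u, v) ∈ A ∧ u + lam • v = f := by
    have h1 : 0 < 1 - lam * ω := by linarith
    obtain ⟨⟨u, w⟩, ⟨v, hv, hw⟩, he⟩ :=
      hA.range (show 0 < lam / (1 - lam * ω) by positivity) ((1 - lam * ω)⁻¹ • f)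
    simp only at hv hw he
    refine ⟨u, v, hv, ?_⟩
    have : f = (1 - lam * ω) • (u + (lam / (1 - lam * ω)) • w) := by
      rw [he, smul_smul, mul_inv_cancel₀ h1.ne', one_smul]
    rw [this, hw, smul_add, smul_smul, mul_div_cancel₀ _ h1.ne']
    module
  have e : opResolvent A lam f = hex.choose := by rw [opResolvent, dif_pos hex]
  obtain ⟨v, hv, hf⟩ := hex.choose_spec
  rw [← e] at hv hf
  convert hv using 2
  rw [inv_smul_eq_iff₀ hlam.ne', sub_eq_iff_eq_add', hf]

theorem norm_opResolvent_sub_le [CompleteSpace X] (hA : IsMAccretive (opShift A ω)) {lam : ℝ}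
    (hlam : 0 < lam) (hω : lam * ω < 1) (f g : X) :
    ‖opResolvent A lam f - opResolvent A lam g‖ ≤ (1 - lam * ω)⁻¹ * ‖f - g‖ := by
  have h1 : 0 < 1 - lam * ω := by linarith
  have := hA.1.one_sub_mul_norm_le (opResolvent_mem hA hlam hω f) (opResolvent_mem hA hlam hω g)
    hlam.le hω
  rw [le_inv_mul_iff₀ h1]
  refine this.trans (le_of_eq ?_)
  congr 1
  rw [← smul_sub, smul_smul, mul_inv_cancel₀ hlam.ne', one_smul]
  abel

theorem norm_opResolvent_iterate_sub_le [CompleteSpace X] (hA : IsMAccretive (opShift A ω))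
    {lam : ℝ} (hlam : 0 < lam) (hω : lam * ω < 1) (f g : X) (n : ℕ) :
    ‖(opResolvent A lam)^[n] f - (opResolvent A lam)^[n] g‖
      ≤ (1 - lam * ω)⁻¹ ^ n * ‖f - g‖ := by
  have h1 : 0 < 1 - lam * ω := by linarith
  induction n with
  | zero => simp
  | succ n ih =>
    rw [Function.iterate_succ_apply', Function.iterate_succ_apply', pow_succ', mul_assoc]
    exact (norm_opResolvent_sub_le hA hlam hω _ _).trans
      (mul_le_mul_of_nonneg_left ih (by positivity))

theorem norm_opResolvent_sub_self_le [CompleteSpace X] (hA : IsMAccretive (opShift A ω))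
    {lam : ℝ} (hlam : 0 < lam) (hω : lam * ω < 1) {x v : X} (hx : (x, v) ∈ A) :
    ‖x - opResolvent A lam x‖ ≤ (1 - lam * ω)⁻¹ * (lam * ‖v‖) := by
  have h1 : 0 < 1 - lam * ω := by linarith
  have := hA.1.one_sub_mul_norm_le hx (opResolvent_mem hA hlam hω x) hlam.le hω
  rw [le_inv_mul_iff₀ h1]
  refine this.trans (le_of_eq ?_)
  rw [smul_sub, smul_smul, mul_inv_cancel₀ hlam.ne', one_smul, add_sub_cancel, norm_smul,
    Real.norm_of_nonneg hlam.le]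

/-- Along the iterates of the resolvent the operator grows at most geometrically. -/
theorem exists_opResolvent_iterate_mem [CompleteSpace X] (hA : IsMAccretive (opShift A ω))
    {lam : ℝ} (hlam : 0 < lam) (hω : lam * ω < 1) {x v : X} (hx : (x, v) ∈ A) (n : ℕ) :
    ∃ w, ((opResolvent A lam)^[n] x, w) ∈ A ∧ ‖w‖ ≤ (1 - lam * ω)⁻¹ ^ n * ‖v‖ := by
  have h1 : 0 < 1 - lam * ω := by linarith
  induction n with
  | zero => exact ⟨v, by simpa using hx, by simp⟩
  | succ n ih =>
    obtain ⟨w, hw, hwv⟩ := ih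
    rw [Function.iterate_succ_apply']
    refine ⟨_, opResolvent_mem hA hlam hω _, ?_⟩
    rw [norm_smul, Real.norm_of_nonneg (by positivity), inv_mul_le_iff₀ hlam]
    refine (norm_opResolvent_sub_self_le hA hlam hω hw).trans ?_
    calc (1 - lam * ω)⁻¹ * (lam * ‖w‖)
        ≤ (1 - lam * ω)⁻¹ * (lam * ((1 - lam * ω)⁻¹ ^ n * ‖v‖)) := by gcongr
      _ = _ := by ring

theorem norm_sub_opResolvent_iterate_le [CompleteSpace X] (hA : IsMAccretive (opShift A ω))
    (hω0 : 0 ≤ ω) {lam : ℝ} (hlam : 0 < lam) (hω : lam * ω < 1) {x v : X} (hx : (x, v) ∈ A)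
    (n : ℕ) : ‖x - (opResolvent A lam)^[n] x‖ ≤ (1 - lam * ω)⁻¹ ^ n * (n * lam * ‖v‖) := by
  have h1 : 0 < 1 - lam * ω := by linarith
  have h2 : 1 ≤ (1 - lam * ω)⁻¹ := by
    rw [one_le_inv₀ h1]; nlinarith [mul_nonneg hlam.le hω0]
  induction n with
  | zero => simp
  | succ n ih =>
    obtain ⟨w, hw, hwv⟩ := exists_opResolvent_iterate_mem hA hlam hω hx n
    have h3 := norm_opResolvent_sub_self_le hA hlam hω hw
    rw [← Function.iterate_succ_apply' (opResolvent A lam)] at h3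
    have h4 : (1 - lam * ω)⁻¹ ^ n ≤ (1 - lam * ω)⁻¹ ^ (n + 1) :=
      pow_le_pow_right₀ h2 (Nat.le_succ n)
    calc ‖x - (opResolvent A lam)^[n + 1] x‖
        ≤ ‖x - (opResolvent A lam)^[n] x‖
          + ‖(opResolvent A lam)^[n] x - (opResolvent A lam)^[n + 1] x‖ :=
          norm_sub_le_norm_sub_add_norm_sub _ _ _
      _ ≤ (1 - lam * ω)⁻¹ ^ n * (n * lam * ‖v‖)
          + (1 - lam * ω)⁻¹ * (lam * ((1 - lam * ω)⁻¹ ^ n * ‖v‖)) := by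
          refine add_le_add ih (h3.trans ?_)
          gcongr
      _ ≤ (1 - lam * ω)⁻¹ ^ (n + 1) * (n * lam * ‖v‖)
          + (1 - lam * ω)⁻¹ ^ (n + 1) * (lam * ‖v‖) := by
          refine add_le_add (by gcongr) (le_of_eq (by ring))
      _ = _ := by push_cast; ring

/-- Kobayashi's estimate for the distance of iterates of two resolvents. -/
theorem norm_opResolvent_iterate_sub_iterate_le [CompleteSpace X]
    (hA : IsMAccretive (opShift A ω)) (hω0 : 0 ≤ ω) {lam mu : ℝ} (hlam : 0 < lam) (hmu : 0 < mu)
    (hlω : lam * ω < 1) (hmω : mu * ω < 1) {x v : X} (hx : (x, v) ∈ A) (n m : ℕ) :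
    ‖(opResolvent A lam)^[n] x - (opResolvent A mu)^[m] x‖ ≤
      (1 - lam * ω)⁻¹ ^ n * (1 - mu * ω)⁻¹ ^ m *
        (‖v‖ * √((n * lam - m * mu) ^ 2 + n * lam ^ 2 + m * mu ^ 2)) := by
  have ha : 0 < 1 - lam * ω := by linarith
  have hb : 0 < 1 - mu * ω := by linarith
  induction n generalizing m with
  | zero =>
    have h := norm_sub_opResolvent_iterate_le hA hω0 hmu hmω hx m
    have h2 : m * mu ≤ √((((0 : ℕ) : ℝ) * lam - m * mu) ^ 2 + ((0 : ℕ) : ℝ) * lam ^ 2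
        + m * mu ^ 2) := by
      apply Real.le_sqrt_of_sq_le
      have : 0 ≤ m * mu ^ 2 := by positivity
      push_cast
      linarith
    rw [Function.iterate_zero, id, pow_zero, one_mul]
    refine h.trans ?_
    rw [mul_comm (m * mu)]
    gcongr
  | succ n ihn =>
    induction m with
    | zero =>
      have h := norm_sub_opResolvent_iterate_le hA hω0 hlam hlω hx (n + 1)
      have h2 : (n + 1 : ℕ) * lam ≤ √((((n + 1 : ℕ) : ℝ) * lam - ((0 : ℕ) : ℝ) * mu) ^ 2
          + ((n + 1 : ℕ) : ℝ) * lam ^ 2 + ((0 : ℕ) : ℝ) * mu ^ 2) := by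
        apply Real.le_sqrt_of_sq_le
        have : 0 ≤ ((n + 1 : ℕ) : ℝ) * lam ^ 2 := by positivity
        push_cast at this ⊢
        linarith
      rw [Function.iterate_zero, id, pow_zero, mul_one, norm_sub_rev]
      refine h.trans ?_
      rw [mul_comm (((n + 1 : ℕ) : ℝ) * lam)]
      gcongr
    | succ m ihm =>
      have ih1 := ihn (m + 1)
      set a := 1 - lam * ω
      set b := 1 - mu * ω
      -- The weights are chosen so that τ / lam = p and τ / mu = p' add up to 1. In the accretivity
      -- inequality with parameter τ the right-hand side is then a convex combination of U' - V and
      -- U - V', the two earlier index pairs.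
      set p := mu / (lam + mu) with hp
      set p' := lam / (lam + mu) with hp'
      have hp0 : 0 ≤ p := by positivity
      have hp0' : 0 ≤ p' := by positivity
      have hpp : p' + p = 1 := by rw [hp, hp']; field_simp
      set τ := lam * p with hτ
      have hτ' : τ = mu * p' := by rw [hτ, hp, hp']; ring
      have hτ0 : 0 ≤ τ := by positivity
      have hτl : τ ≤ lam := by rw [hτ]; nlinarith
      have hτm : τ ≤ mu := by rw [hτ']; nlinarith
      -- Each earlier pair lacks one factor `a⁻¹` or `b⁻¹`; the resulting `a` or `b` is absorbed by
      -- 1 - τω on the left.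
      have haτ : a ≤ 1 - τ * ω := by simp only [a]; nlinarith
      have hbτ : b ≤ 1 - τ * ω := by simp only [b]; nlinarith
      have hτω : 0 < 1 - τ * ω := ha.trans_le haτ
      set U := (opResolvent A lam)^[n] x with hU
      set U' := (opResolvent A lam)^[n + 1] x with hU'
      set V := (opResolvent A mu)^[m] x with hV
      set V' := (opResolvent A mu)^[m + 1] x with hV'
      have hUm : (U', lam⁻¹ • (U - U')) ∈ A := by
        rw [hU', Function.iterate_succ_apply']
        exact opResolvent_mem hA hlam hlω _
      have hVm : (V', mu⁻¹ • (V - V')) ∈ A := by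
        rw [hV', Function.iterate_succ_apply']
        exact opResolvent_mem hA hmu hmω _
      have key := hA.1.one_sub_mul_norm_le hUm hVm hτ0 (by linarith)
      have e : U' - V' + τ • (lam⁻¹ • (U - U') - mu⁻¹ • (V - V'))
          = p' • (U' - V) + p • (U - V') := by
        have e1 : τ * lam⁻¹ = p := by rw [hτ]; field_simp
        have e2 : τ * mu⁻¹ = p' := by rw [hτ']; field_simp
        rw [smul_sub, smul_smul, smul_smul, e1, e2]
        have : U' - V' = (p' + p) • (U' - V') := by rw [hpp, one_smul]
        rw [this]
        module
      rw [e] at key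
      set D := ((n + 1 : ℕ) * lam - (m + 1 : ℕ) * mu) ^ 2 + (n + 1 : ℕ) * lam ^ 2
        + (m + 1 : ℕ) * mu ^ 2 with hD
      set D1 := ((n + 1 : ℕ) * lam - m * mu) ^ 2 + (n + 1 : ℕ) * lam ^ 2 + m * mu ^ 2 with hD1
      set D2 := (n * lam - (m + 1 : ℕ) * mu) ^ 2 + n * lam ^ 2 + (m + 1 : ℕ) * mu ^ 2 with hD2
      -- The radicand is exactly reproduced by this averaging, so concavity of the square root
      -- closes the induction.
      have hDD : p' * D1 + p * D2 = D := by
        rw [hD, hD1, hD2, hp, hp']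
        push_cast
        field_simp
        ring
      have hconc : p' * √D1 + p * √D2 ≤ √D := by
        have := Real.strictConcaveOn_sqrt.concaveOn.2 (show D1 ∈ Ici 0 from by
          rw [mem_Ici, hD1]; positivity) (show D2 ∈ Ici 0 from by
          rw [mem_Ici, hD2]; positivity) hp0' hp0 hpp
        simpa [hDD] using this
      have hN : ‖p' • (U' - V) + p • (U - V')‖ ≤ p' * ‖U' - V‖ + p * ‖U - V'‖ := by
        refine (norm_add_le _ _).trans (le_of_eq ?_)
        rw [norm_smul, norm_smul, Real.norm_of_nonneg hp0, Real.norm_of_nonneg hp0']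
      rw [← mul_le_mul_iff_right₀ hτω]
      calc (1 - τ * ω) * ‖U' - V'‖ ≤ p' * ‖U' - V‖ + p * ‖U - V'‖ := key.trans hN
        _ ≤ p' * (a⁻¹ ^ (n + 1) * b⁻¹ ^ m * (‖v‖ * √D1))
            + p * (a⁻¹ ^ n * b⁻¹ ^ (m + 1) * (‖v‖ * √D2)) := by gcongr
        _ = a⁻¹ ^ (n + 1) * b⁻¹ ^ (m + 1) * ‖v‖ * (p' * (b * √D1) + p * (a * √D2)) := by
            have e1 : a⁻¹ ^ (n + 1) * a = a⁻¹ ^ n := by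
              rw [pow_succ, mul_assoc, inv_mul_cancel₀ ha.ne', mul_one]
            have e2 : b⁻¹ ^ (m + 1) * b = b⁻¹ ^ m := by
              rw [pow_succ, mul_assoc, inv_mul_cancel₀ hb.ne', mul_one]
            rw [← e1, ← e2]
            ring
        _ ≤ a⁻¹ ^ (n + 1) * b⁻¹ ^ (m + 1) * ‖v‖
            * (p' * ((1 - τ * ω) * √D1) + p * ((1 - τ * ω) * √D2)) := by gcongr
        _ = a⁻¹ ^ (n + 1) * b⁻¹ ^ (m + 1) * ‖v‖ * ((1 - τ * ω) * (p' * √D1 + p * √D2)) := by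
            ring
        _ ≤ a⁻¹ ^ (n + 1) * b⁻¹ ^ (m + 1) * ‖v‖ * ((1 - τ * ω) * √D) := by gcongr
        _ = _ := by ring

end Resolvent

/-! ### The exponential formula and errors of the Euler scheme -/

section Semigroup

variable {X : Type*} [NormedAddCommGroup X] [NormedSpace ℝ X] {A : Set (X × X)} {ω : ℝ}

/-- The crude factor 2 is harmless: it enters only Lipschitz constants and errors that vanish in the
limit. -/
theorem inv_one_sub_pow_le_exp {x : ℝ} (h0 : 0 ≤ x) (h1 : x ≤ 1 / 2) (n : ℕ) :
    (1 - x)⁻¹ ^ n ≤ Real.exp (2 * (n * x)) := by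
  have h2 : (1 - x)⁻¹ ≤ Real.exp (2 * x) := by
    rw [inv_le_iff_one_le_mul₀ (by linarith)]
    have := Real.add_one_le_exp (2 * x)
    nlinarith
  calc (1 - x)⁻¹ ^ n ≤ Real.exp (2 * x) ^ n :=
        pow_le_pow_left₀ (inv_nonneg.2 (by linarith)) h2 n
    _ = Real.exp (2 * (n * x)) := by rw [← Real.exp_nat_mul]; ring_nf

theorem eventually_div_mul_le_half (t ω : ℝ) : ∀ᶠ n : ℕ in atTop, t / n * ω ≤ 1 / 2 := by
  have h : Tendsto (fun n : ℕ => t / n * ω) atTop (𝓝 (0 * ω)) :=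
    (tendsto_const_div_atTop_nhds_zero_nat t).mul_const ω
  rw [zero_mul] at h
  exact h.eventually_le_const (by norm_num)

/-- Both schemes end at time t, so the squared time difference in Kobayashi's radicand vanishes. -/
theorem norm_opResolvent_div_iterate_sub_le [CompleteSpace X]
    (hA : IsMAccretive (opShift A ω)) (hω0 : 0 ≤ ω) {t : ℝ} (ht : 0 < t) {n m : ℕ} (hn : 0 < n)
    (hm : 0 < m) (hnω : t / n * ω ≤ 1 / 2) (hmω : t / m * ω ≤ 1 / 2) {x v : X}
    (hx : (x, v) ∈ A) :
    ‖(opResolvent A (t / n))^[n] x - (opResolvent A (t / m))^[m] x‖ ≤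
      Real.exp (4 * (ω * t)) * (‖v‖ * √(t * (t / n) + t * (t / m))) := by
  have hn' : (0 : ℝ) < n := by exact_mod_cast hn
  have hm' : (0 : ℝ) < m := by exact_mod_cast hm
  have key := norm_opResolvent_iterate_sub_iterate_le hA hω0 (lam := t / n) (mu := t / m)
    (by positivity) (by positivity) (by linarith) (by linarith) hx n m
  have e : (n * (t / n) - m * (t / m)) ^ 2 + n * (t / n) ^ 2 + m * (t / m) ^ 2
      = t * (t / n) + t * (t / m) := by field_simp; ring
  rw [e] at key
  refine key.trans ?_
  have e1 := inv_one_sub_pow_le_exp (x := t / n * ω) (by positivity) hnω n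
  have e2 := inv_one_sub_pow_le_exp (x := t / m * ω) (by positivity) hmω m
  have e3 : Real.exp (4 * (ω * t)) = Real.exp (2 * (n * (t / n * ω)))
      * Real.exp (2 * (m * (t / m * ω))) := by
    rw [← Real.exp_add]
    congr 1
    field_simp
    ring
  rw [e3]
  have : 0 < 1 - t / m * ω := by linarith
  gcongr

/-- The exponential formula on the domain. -/
theorem cauchySeq_opResolvent_div_iterate [CompleteSpace X] (hA : IsMAccretive (opShift A ω))
    (hω0 : 0 ≤ ω) {t : ℝ} (ht : 0 < t) {x : X} (hx : x ∈ opDomain A) :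
    CauchySeq fun n : ℕ => (opResolvent A (t / n))^[n] x := by
  obtain ⟨v, hx⟩ := hx
  rw [Metric.cauchySeq_iff]
  intro ε hε
  have hb : Tendsto (fun N : ℕ => Real.exp (4 * (ω * t)) * (‖v‖ * √(t * (t / N) + t * (t / N))))
      atTop (𝓝 0) := by
    have h := tendsto_const_div_atTop_nhds_zero_nat t
    have h2 := ((((h.const_mul t).add (h.const_mul t)).sqrt).const_mul ‖v‖).const_mul
      (Real.exp (4 * (ω * t)))
    simpa using h2
  obtain ⟨N, hN1, hN2, hN3⟩ := ((hb.eventually_lt_const hε).and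
    ((eventually_div_mul_le_half t ω).and (eventually_gt_atTop 0))).exists
  have hN : (0 : ℝ) < N := by exact_mod_cast hN3
  have hle : ∀ n ≥ N, t / n ≤ t / N := fun n hn => by gcongr
  refine ⟨N, fun m hm n hn => ?_⟩
  rw [dist_eq_norm]
  have hmle := hle m hm
  have hnle := hle n hn
  have hm2 : t / m * ω ≤ 1 / 2 := (mul_le_mul_of_nonneg_right hmle hω0).trans hN2
  have hn2 : t / n * ω ≤ 1 / 2 := (mul_le_mul_of_nonneg_right hnle hω0).trans hN2
  refine (norm_opResolvent_div_iterate_sub_le hA hω0 ht (by lia) (by lia)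
    hm2 hn2 hx).trans_lt (lt_of_le_of_lt ?_ hN1)
  gcongr

theorem eventually_norm_opResolvent_div_iterate_sub_le [CompleteSpace X]
    (hA : IsMAccretive (opShift A ω)) (hω0 : 0 ≤ ω) {t : ℝ} (ht : 0 < t) :
    ∀ᶠ n : ℕ in atTop, ∀ x y : X,
      ‖(opResolvent A (t / n))^[n] x - (opResolvent A (t / n))^[n] y‖
        ≤ Real.exp (2 * (ω * t)) * ‖x - y‖ := by
  filter_upwards [eventually_div_mul_le_half t ω, eventually_gt_atTop 0] with n hn hn0 x y
  have hn' : (0 : ℝ) < n := by exact_mod_cast hn0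
  refine (norm_opResolvent_iterate_sub_le hA (by positivity) (by linarith) x y n).trans ?_
  have h := inv_one_sub_pow_le_exp (x := t / n * ω) (by positivity) hn n
  have e : 2 * (n * (t / n * ω)) = 2 * (ω * t) := by field_simp
  rw [e] at h
  gcongr

/-- The exponential formula on the closure of the domain. -/
theorem tendsto_opSemigroup [CompleteSpace X] (hA : IsMAccretive (opShift A ω))
    (hω0 : 0 ≤ ω) {t : ℝ} (ht : 0 < t) {x : X} (hx : x ∈ closure (opDomain A)) :
    Tendsto (fun n : ℕ => (opResolvent A (t / n))^[n] x) atTop (𝓝 (opSemigroup A t x)) := by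
  have hc : CauchySeq fun n : ℕ => (opResolvent A (t / n))^[n] x := by
    rw [Metric.cauchySeq_iff]
    intro ε hε
    set L := Real.exp (2 * (ω * t)) with hL
    have hL0 : 0 < L := Real.exp_pos _
    obtain ⟨y, hy, hxy⟩ := Metric.mem_closure_iff.1 hx (ε / 3 / L) (by positivity)
    rw [dist_eq_norm, lt_div_iff₀' hL0] at hxy
    obtain ⟨N, hN⟩ := Metric.cauchySeq_iff.1 (cauchySeq_opResolvent_div_iterate hA hω0 ht hy)
      (ε / 3) (by positivity)
    obtain ⟨M, hM⟩ := eventually_atTop.1 (eventually_norm_opResolvent_div_iterate_sub_le hA hω0 ht)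
    refine ⟨max N M, fun m hm n hn => ?_⟩
    have h1 := hN m (le_of_max_le_left hm) n (le_of_max_le_left hn)
    have h2 := hM m (le_of_max_le_right hm) x y
    have h3 := hM n (le_of_max_le_right hn) x y
    rw [← hL, ← dist_eq_norm] at h2 h3
    have := dist_triangle4_right ((opResolvent A (t / m))^[m] x) ((opResolvent A (t / n))^[n] x)
      ((opResolvent A (t / m))^[m] y) ((opResolvent A (t / n))^[n] y)
    linarith
  rw [opSemigroup, if_pos ht]
  exact hc.tendsto_limUnder

theorem norm_opSemigroup_sub_le [CompleteSpace X] (hA : IsMAccretive (opShift A ω))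
    (hω0 : 0 ≤ ω) {t : ℝ} (ht : 0 < t) {x y : X} (hx : x ∈ closure (opDomain A))
    (hy : y ∈ closure (opDomain A)) :
    ‖opSemigroup A t x - opSemigroup A t y‖ ≤ Real.exp (2 * (ω * t)) * ‖x - y‖ :=
  le_of_tendsto ((tendsto_opSemigroup hA hω0 ht hx).sub (tendsto_opSemigroup hA hω0 ht hy)).norm
    ((eventually_norm_opResolvent_div_iterate_sub_le hA hω0 ht).mono fun _ h => h x y)

/-- The error of the implicit Euler scheme with step `lam` after `j` steps. -/
theorem norm_opResolvent_iterate_sub_opSemigroup_le [CompleteSpace X]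
    (hA : IsMAccretive (opShift A ω)) (hω0 : 0 ≤ ω) {lam : ℝ} (hlam : 0 < lam)
    (hlω : lam * ω ≤ 1 / 2) {x v : X} (hx : (x, v) ∈ A) (j : ℕ) :
    ‖(opResolvent A lam)^[j] x - opSemigroup A (j * lam) x‖ ≤
      Real.exp (4 * (ω * (j * lam))) * (‖v‖ * √(j * lam * lam)) := by
  rcases Nat.eq_zero_or_pos j with rfl | hj
  · simp [opSemigroup]
  have hj' : (0 : ℝ) < j := by exact_mod_cast hj
  set s := j * lam with hs
  have hs0 : 0 < s := by positivity
  have hsj : s / j = lam := by rw [hs]; field_simp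
  have hlim := (tendsto_opSemigroup hA hω0 hs0 (subset_closure ⟨v, hx⟩)).const_sub
    ((opResolvent A lam)^[j] x)
  have hb : Tendsto (fun m : ℕ => Real.exp (4 * (ω * s)) * (‖v‖ * √(s * lam + s * (s / m))))
      atTop (𝓝 (Real.exp (4 * (ω * s)) * (‖v‖ * √(s * lam)))) := by
    have h := tendsto_const_div_atTop_nhds_zero_nat s
    have h2 := ((((h.const_mul s).const_add (s * lam)).sqrt).const_mul ‖v‖).const_mul
      (Real.exp (4 * (ω * s)))
    simpa using h2
  refine le_of_tendsto_of_tendsto hlim.norm hb ?_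
  filter_upwards [eventually_div_mul_le_half s ω, eventually_gt_atTop 0] with m hm hm0
  have := norm_opResolvent_div_iterate_sub_le hA hω0 hs0 hj hm0 (by rwa [hsj]) hm hx
  rwa [hsj] at this

/-- Replacing the last steps of the Euler scheme by the semigroup gives the same limit. -/
theorem tendsto_opSemigroup_opResolvent_iterate [CompleteSpace X]
    (hA : IsMAccretive (opShift A ω)) (hω0 : 0 ≤ ω) {t : ℝ} (ht : 0 < t) {x : X}
    (hx : x ∈ opDomain A) {k : ℕ → ℕ} (hk : ∀ n, k n ≤ n) :
    Tendsto (fun n : ℕ => opSemigroup A ((n - k n : ℕ) * (t / n))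
      ((opResolvent A (t / n))^[k n] x)) atTop (𝓝 (opSemigroup A t x)) := by
  have h1 := tendsto_opSemigroup hA hω0 ht (subset_closure hx)
  obtain ⟨v, hv⟩ := hx
  have hb : Tendsto (fun n : ℕ => Real.exp (4 * (ω * t)) *
      (Real.exp (2 * (ω * t)) * ‖v‖ * √(t * (t / n)))) atTop (𝓝 0) := by
    have h := tendsto_const_div_atTop_nhds_zero_nat t
    have h2 := (((h.const_mul t).sqrt).const_mul (Real.exp (2 * (ω * t)) * ‖v‖)).const_mul
      (Real.exp (4 * (ω * t)))
    simpa using h2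
  have h2 : Tendsto (fun n : ℕ => (opResolvent A (t / n))^[n] x
      - opSemigroup A ((n - k n : ℕ) * (t / n)) ((opResolvent A (t / n))^[k n] x)) atTop
      (𝓝 0) := by
    refine squeeze_zero_norm' ?_ hb
    filter_upwards [eventually_div_mul_le_half t ω, eventually_gt_atTop 0] with n hn hn0
    have hn' : (0 : ℝ) < n := by exact_mod_cast hn0
    have hl : 0 < t / n := by positivity
    -- The Euler error is applied with the k-th iterate as starting point; the bound on `w` does not
    -- depend on k, which makes the convergence uniform in the choice of `k n`.
    obtain ⟨w, hw, hwv⟩ := exists_opResolvent_iterate_mem hA hl (by linarith) hv (k n)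
    have h3 := norm_opResolvent_iterate_sub_opSemigroup_le hA hω0 hl hn hw (n - k n)
    rw [← Function.iterate_add_apply, Nat.sub_add_cancel (hk n)] at h3
    have h4 : ((n - k n : ℕ) : ℝ) * (t / n) ≤ t := by
      have : ((n - k n : ℕ) : ℝ) ≤ n := by exact_mod_cast Nat.sub_le _ _
      calc ((n - k n : ℕ) : ℝ) * (t / n) ≤ n * (t / n) := by gcongr
        _ = t := by field_simp
    have h5 : ‖w‖ ≤ Real.exp (2 * (ω * t)) * ‖v‖ := by
      refine hwv.trans ?_
      have h6 := inv_one_sub_pow_le_exp (x := t / n * ω) (by positivity) hn (k n)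
      have h7 : (k n : ℝ) * (t / n * ω) ≤ ω * t := by
        have : (k n : ℝ) ≤ n := by exact_mod_cast hk n
        calc (k n : ℝ) * (t / n * ω) ≤ n * (t / n * ω) := by gcongr
          _ = ω * t := by field_simp
      have h8 := h6.trans (Real.exp_le_exp.2 (mul_le_mul_of_nonneg_left h7 zero_le_two))
      gcongr
    exact h3.trans (by gcongr)
  simpa using h1.sub h2

end Semigroup

/-! ### Discrete Gronwall argument and the limit of the Euler factors -/

section Real

/-- A discrete Gronwall type pigeonhole principle. -/
theorem exists_natCast_mul_le_of_le_mul_sub {N a : ℕ → ℝ} {β K : ℝ} (hN : ∀ k, 0 ≤ N k)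
    (ha : ∀ k, 0 ≤ a k) (hβ : 0 < β) (hβ1 : β ≤ 1) (hK : 0 ≤ K)
    (h : ∀ k, N (k + 1) ≤ K * (a k - β * a (k + 1))) {n : ℕ} (hn : 0 < n) :
    ∃ k < n, n * N (k + 1) ≤ K * (β⁻¹ ^ n * a 0) := by
  -- The weights β ^ k make the right-hand sides telescope.
  have h1 : ∀ m, ∑ k ∈ Finset.range m, β ^ k * N (k + 1) ≤ K * (a 0 - β ^ m * a m) := by
    intro m
    induction m with
    | zero => simp
    | succ m ih =>
      rw [Finset.sum_range_succ]
      have := mul_le_mul_of_nonneg_left (h m) (pow_nonneg hβ.le m)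
      calc _ ≤ K * (a 0 - β ^ m * a m) + β ^ m * (K * (a m - β * a (m + 1))) := by gcongr
        _ = _ := by ring
  have h2 : ∑ k ∈ Finset.range n, N (k + 1)
      ≤ ∑ k ∈ Finset.range n, K * (β⁻¹ ^ n * a 0) / n := by
    rw [Finset.sum_const, Finset.card_range, nsmul_eq_mul]
    have hn' : (n : ℝ) ≠ 0 := by exact_mod_cast hn.ne'
    rw [mul_div_cancel₀ _ hn', inv_pow]
    have h3 : ∑ k ∈ Finset.range n, β ^ n * N (k + 1)
        ≤ ∑ k ∈ Finset.range n, β ^ k * N (k + 1) :=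
      Finset.sum_le_sum fun k hk => mul_le_mul_of_nonneg_right
        (pow_le_pow_of_le_one hβ.le hβ1 (Finset.mem_range.1 hk).le) (hN _)
    rw [← Finset.mul_sum] at h3
    have h4 : K * (a 0 - β ^ n * a n) ≤ K * a 0 := by
      have := ha n
      gcongr
      have : 0 ≤ β ^ n * a n := by positivity
      linarith
    have h5 := h3.trans ((h1 n).trans h4)
    rw [← le_inv_mul_iff₀ (pow_pos hβ n)] at h5
    linarith
  obtain ⟨k, hk, hkn⟩ := Finset.exists_le_of_sum_le ⟨0, Finset.mem_range.2 hn⟩ h2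
  refine ⟨k, Finset.mem_range.1 hk, ?_⟩
  rwa [le_div_iff₀' (by exact_mod_cast hn)] at hkn

/-- This limit supplies the sharp exponential rate in the final constant. -/
theorem tendsto_inv_one_sub_div_mul_pow (t c : ℝ) :
    Tendsto (fun n : ℕ => (1 - t / n * c)⁻¹ ^ n) atTop (𝓝 (Real.exp (c * t))) := by
  have h := (Real.tendsto_one_add_div_pow_exp (-(c * t))).inv₀ (Real.exp_ne_zero _)
  rw [← Real.exp_neg, neg_neg] at h
  refine h.congr fun n => ?_
  rw [inv_pow]
  congr 2
  ring

end Real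

/-! ### Smoothing from L^q to L^r -/

section Lebesgue

variable {S : Type*} [MeasurableSpace S] {μ : Measure S} {q : ℝ≥0∞} [Fact (1 ≤ q)]

theorem one_le_toReal_of_fact (hq : q ≠ ∞) : 1 ≤ q.toReal := by
  simpa using ENNReal.toReal_mono hq (Fact.out : (1 : ℝ≥0∞) ≤ q)

/-- Lower semicontinuity of the `L^r` norm with respect to convergence in `L^q`. -/
theorem memLp_and_eLpNorm_toReal_le_of_tendsto {r : ℝ≥0∞} {f : ℕ → Lp ℝ q μ} {g : Lp ℝ q μ}
    {b : ℕ → ℝ} {B : ℝ} (hf : Tendsto f atTop (𝓝 g)) (hb : Tendsto b atTop (𝓝 B))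
    (h : ∀ᶠ n in atTop, MemLp (f n) r μ ∧ (eLpNorm (f n) r μ).toReal ≤ b n) :
    MemLp g r μ ∧ (eLpNorm g r μ).toReal ≤ B := by
  have hB : 0 ≤ B := ge_of_tendsto hb (h.mono fun n hn => ENNReal.toReal_nonneg.trans hn.2)
  have key : ∀ ε : ℝ, 0 < ε → eLpNorm g r μ ≤ ENNReal.ofReal (B + ε) := by
    intro ε hε
    refine eLpNorm_le_of_tendstoInMeasure (f := fun n => (f n : S → ℝ)) (u := atTop) ?_
      (tendstoInMeasure_of_tendsto_Lp hf) (fun n => Lp.aestronglyMeasurable _)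
    filter_upwards [h, hb.eventually_lt_const (show B < B + ε by linarith)] with n hn hbn
    rw [← ENNReal.ofReal_toReal hn.1.eLpNorm_ne_top]
    exact ENNReal.ofReal_le_ofReal (hn.2.trans hbn.le)
  refine ⟨⟨Lp.aestronglyMeasurable _, (key 1 one_pos).trans_lt ENNReal.ofReal_lt_top⟩, ?_⟩
  refine le_of_forall_pos_le_add fun ε hε => ?_
  exact ENNReal.toReal_le_of_le_ofReal (by linarith) (key ε hε)

/-- Difference quotients of a convex function at 0 increase with the step, so their limit lies below
the quotient at `lam`. -/
theorem mul_qBracket_le (hq : q ≠ ∞) (u v : Lp ℝ q μ) {lam : ℝ} (hlam : 0 < lam) :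
    lam * qBracket u v ≤ 1 / q.toReal * (‖u + lam • v‖ ^ q.toReal - ‖u‖ ^ q.toReal) := by
  have hq1 := one_le_toReal_of_fact hq
  rw [← le_div_iff₀' hlam]
  refine le_of_tendsto (tendsto_qBracket hq u v) ?_
  filter_upwards [Ioo_mem_nhdsGT hlam] with s hs
  obtain ⟨hs0, hsl⟩ := hs
  rw [← mul_sub, mul_div_assoc, mul_div_assoc]
  refine mul_le_mul_of_nonneg_left ?_ (by positivity)
  rw [div_le_div_iff₀ hs0 hlam]
  set θ := s / lam with hθ
  have hθ0 : 0 ≤ θ := by positivity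
  have hθ1 : 0 ≤ 1 - θ := by rw [sub_nonneg, hθ, div_le_one hlam]; exact hsl.le
  have e : u + s • v = (1 - θ) • u + θ • (u + lam • v) := by
    have : s = θ * lam := by rw [hθ]; field_simp
    rw [this]; module
  have h1 : ‖u + s • v‖ ≤ (1 - θ) * ‖u‖ + θ * ‖u + lam • v‖ := by
    rw [e]
    refine (norm_add_le _ _).trans (le_of_eq ?_)
    rw [norm_smul, norm_smul, Real.norm_of_nonneg hθ0, Real.norm_of_nonneg hθ1]
  have h2 := (convexOn_rpow hq1).2 (show ‖u‖ ∈ Ici (0 : ℝ) from norm_nonneg _)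
    (show ‖u + lam • v‖ ∈ Ici (0 : ℝ) from norm_nonneg _) hθ1 hθ0 (by ring)
  have h3 := (Real.rpow_le_rpow (norm_nonneg _) h1 (by linarith)).trans h2
  simp only [smul_eq_mul] at h3
  have h4 := mul_le_mul_of_nonneg_right h3 hlam.le
  have h5 : θ * lam = s := by rw [hθ]; field_simp
  calc _ ≤ ((1 - θ) * ‖u‖ ^ q.toReal + θ * ‖u + lam • v‖ ^ q.toReal) * lam
        - ‖u‖ ^ q.toReal * lam := by rw [sub_mul]; gcongr
    _ = _ := by rw [← h5]; ring

variable {A : Set (Lp ℝ q μ × Lp ℝ q μ)} {r : ℝ≥0∞} {ω ϱ σ C : ℝ}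

/-- The Gagliardo–Nirenberg type inequality along one step of the implicit Euler scheme. -/
theorem GagliardoNirenbergWithDifferences.opResolvent_step (hq : q ≠ ∞) (hC : 0 < C)
    (hA : IsMAccretive (opShift A ω)) (hGN : GagliardoNirenbergWithDifferences A r ϱ σ ω C)
    {lam : ℝ} (hlam : 0 < lam) (hω : lam * ω < 1) (f g : Lp ℝ q μ) :
    MemLp (opResolvent A lam f - opResolvent A lam g : Lp ℝ q μ) r μ ∧
    lam * (eLpNorm (opResolvent A lam f - opResolvent A lam g : Lp ℝ q μ) r μ).toReal ^ σ ≤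
      C / q.toReal * (‖f - g‖ ^ q.toReal - (1 - lam * (q.toReal * ω)) *
        ‖opResolvent A lam f - opResolvent A lam g‖ ^ q.toReal) *
        ‖opResolvent A lam f - opResolvent A lam g‖ ^ ϱ := by
  have hq1 := one_le_toReal_of_fact hq
  obtain ⟨h1, h2⟩ := hGN _ (opResolvent_mem hA hlam hω f) _ (opResolvent_mem hA hlam hω g)
  refine ⟨h1, ?_⟩
  simp only at h2
  set w := opResolvent A lam f - opResolvent A lam g with hw
  have h3 := mul_qBracket_le hq w (lam⁻¹ • (f - opResolvent A lam f)
    - lam⁻¹ • (g - opResolvent A lam g)) hlam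
  have e : w + lam • (lam⁻¹ • (f - opResolvent A lam f)
      - lam⁻¹ • (g - opResolvent A lam g)) = f - g := by
    rw [← smul_sub, smul_smul, mul_inv_cancel₀ hlam.ne', one_smul, hw]
    abel
  rw [e] at h3
  set Q := qBracket w (lam⁻¹ • (f - opResolvent A lam f) - lam⁻¹ • (g - opResolvent A lam g))
  have h4 := mul_le_mul_of_nonneg_left h2 hlam.le
  refine h4.trans ?_
  rw [← mul_assoc]
  refine mul_le_mul_of_nonneg_right ?_ (by positivity)
  calc lam * (C * (Q + ω * ‖w‖ ^ q.toReal)) = C * (lam * Q + lam * ω * ‖w‖ ^ q.toReal) := by ring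
    _ ≤ C * (1 / q.toReal * (‖f - g‖ ^ q.toReal - ‖w‖ ^ q.toReal)
        + lam * ω * ‖w‖ ^ q.toReal) := by gcongr
    _ = _ := by field_simp; ring

/-- One of the first `n` iterates of the resolvent satisfies a smoothing estimate. -/
theorem GagliardoNirenbergWithDifferences.exists_iterate_le (hq : q ≠ ∞) (hω0 : 0 ≤ ω)
    (hϱ : 0 ≤ ϱ) (hC : 0 < C) (hA : IsMAccretive (opShift A ω))
    (hGN : GagliardoNirenbergWithDifferences A r ϱ σ ω C)
    {lam : ℝ} (hlam : 0 < lam) (hω : lam * (q.toReal * ω) < 1) (f g : Lp ℝ q μ) {n : ℕ}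
    (hn : 0 < n) :
    ∃ k ≤ n, MemLp ((opResolvent A lam)^[k] f - (opResolvent A lam)^[k] g : Lp ℝ q μ) r μ ∧
      n * lam * (eLpNorm ((opResolvent A lam)^[k] f - (opResolvent A lam)^[k] g : Lp ℝ q μ)
        r μ).toReal ^ σ ≤
        C / q.toReal * ((1 - lam * ω)⁻¹ ^ n * ‖f - g‖) ^ ϱ *
          ((1 - lam * (q.toReal * ω))⁻¹ ^ n * ‖f - g‖ ^ q.toReal) := by
  have hq1 := one_le_toReal_of_fact hq
  have hlω0 : 0 ≤ lam * ω := by positivity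
  have hlω : lam * ω < 1 := by nlinarith
  have hα : 0 < 1 - lam * ω := by linarith
  have hα1 : 1 ≤ (1 - lam * ω)⁻¹ := by rw [one_le_inv₀ hα]; linarith
  have hβ1 : 0 ≤ lam * (q.toReal * ω) := by positivity
  set J := opResolvent A lam with hJ
  have hstep := fun k : ℕ => hGN.opResolvent_step hq hC hA hlam hlω (J^[k] f) (J^[k] g)
  simp only [← hJ, ← Function.iterate_succ_apply' J] at hstep
  set K := C / q.toReal * ((1 - lam * ω)⁻¹ ^ n * ‖f - g‖) ^ ϱ with hK
  have hK0 : 0 ≤ K := by positivity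
  -- The drop is nonnegative, by Bernoulli's inequality and the resolvent's Lipschitz bound. This
  -- allows its factor ‖w_{k+1}‖^ϱ to be replaced by a bound independent of k.
  have hdecay : ∀ k, (1 - lam * (q.toReal * ω)) * ‖J^[k + 1] f - J^[k + 1] g‖ ^ q.toReal
      ≤ ‖J^[k] f - J^[k] g‖ ^ q.toReal := by
    intro k
    have h1 : (1 - lam * (q.toReal * ω)) ≤ (1 - lam * ω) ^ q.toReal := by
      have := one_add_mul_self_le_rpow_one_add (show -1 ≤ -(lam * ω) by linarith) hq1
      rw [← sub_eq_add_neg] at this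
      linarith
    have h2 := norm_opResolvent_sub_le hA hlam hlω (J^[k] f) (J^[k] g)
    rw [le_inv_mul_iff₀ hα, ← hJ, ← Function.iterate_succ_apply' J,
      ← Function.iterate_succ_apply' J] at h2
    calc _ ≤ (1 - lam * ω) ^ q.toReal * ‖J^[k + 1] f - J^[k + 1] g‖ ^ q.toReal := by gcongr
      _ = ((1 - lam * ω) * ‖J^[k + 1] f - J^[k + 1] g‖) ^ q.toReal :=
        (Real.mul_rpow hα.le (norm_nonneg _)).symm
      _ ≤ _ := by gcongr
  -- The uniform bound on ‖w_k‖ holds only for k ≤ n, while the pigeonhole lemma asks for all k;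
  -- hence the cutoff.
  set N : ℕ → ℝ := fun k => if k ≤ n then
    lam * (eLpNorm (J^[k] f - J^[k] g : Lp ℝ q μ) r μ).toReal ^ σ else 0 with hN
  obtain ⟨k, hk, hkn⟩ := exists_natCast_mul_le_of_le_mul_sub (N := N)
    (a := fun k => ‖J^[k] f - J^[k] g‖ ^ q.toReal) (β := 1 - lam * (q.toReal * ω)) (K := K)
    (fun k => by simp only [hN]; split_ifs <;> positivity) (fun k => by positivity)
    (by linarith) (by linarith) hK0 (fun k => by
      have h0 := sub_nonneg.2 (hdecay k)
      simp only [hN]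
      split_ifs with hkn
      · refine (hstep k).2.trans ?_
        have h3 : ‖J^[k + 1] f - J^[k + 1] g‖ ≤ (1 - lam * ω)⁻¹ ^ n * ‖f - g‖ :=
          (norm_opResolvent_iterate_sub_le hA hlam hlω f g (k + 1)).trans (by gcongr)
        calc _ ≤ C / q.toReal * (‖J^[k] f - J^[k] g‖ ^ q.toReal - (1 - lam * (q.toReal * ω)) *
              ‖J^[k + 1] f - J^[k + 1] g‖ ^ q.toReal) *
              ((1 - lam * ω)⁻¹ ^ n * ‖f - g‖) ^ ϱ := by gcongr
          _ = _ := by rw [hK]; ring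
      · positivity) hn
  refine ⟨k + 1, hk, (hstep k).1, ?_⟩
  simp only [hN, if_pos (Nat.succ_le_of_lt hk)] at hkn
  rw [mul_assoc]
  exact hkn

/-- Time 0 occurs when the selected index k equals n. -/
theorem HasExponentialGrowth.of_nonneg (hgrowth : HasExponentialGrowth A r ω) {u u' : Lp ℝ q μ}
    (hu : u ∈ closure (opDomain A)) (hu' : u' ∈ closure (opDomain A)) {t : ℝ} (ht : 0 ≤ t)
    (h : MemLp (u - u' : Lp ℝ q μ) r μ) :
    MemLp (opSemigroup A t u - opSemigroup A t u' : Lp ℝ q μ) r μ ∧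
      (eLpNorm (opSemigroup A t u - opSemigroup A t u' : Lp ℝ q μ) r μ).toReal ≤
        Real.exp (ω * t) * (eLpNorm (u - u' : Lp ℝ q μ) r μ).toReal := by
  rcases ht.eq_or_lt with rfl | ht
  · simpa [opSemigroup] using h
  · exact hgrowth u hu u' hu' t ht h

/-- The smoothing estimate for initial values in the domain. -/
theorem GagliardoNirenbergWithDifferences.opSemigroup_of_mem_opDomain (hq : q ≠ ∞)
    (hω0 : 0 ≤ ω) (hϱ : 0 ≤ ϱ) (hσ : 0 < σ) (hC : 0 < C) (hA : IsMAccretive (opShift A ω))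
    (hGN : GagliardoNirenbergWithDifferences A r ϱ σ ω C)
    (hgrowth : HasExponentialGrowth A r ω) {t : ℝ} (ht : 0 < t) {u u' : Lp ℝ q μ}
    (hu : u ∈ opDomain A) (hu' : u' ∈ opDomain A) :
    MemLp (opSemigroup A t u - opSemigroup A t u' : Lp ℝ q μ) r μ ∧
      (eLpNorm (opSemigroup A t u - opSemigroup A t u' : Lp ℝ q μ) r μ).toReal ≤
        (C / q.toReal) ^ (1 / σ) * t ^ (-(1 / σ)) *
          Real.exp (ω * ((q.toReal + ϱ) / σ + 1) * t) * ‖u - u'‖ ^ ((q.toReal + ϱ) / σ) := by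
  have hq1 := one_le_toReal_of_fact hq
  set R : ℕ → ℝ := fun n => C / q.toReal * ((1 - t / n * ω)⁻¹ ^ n * ‖u - u'‖) ^ ϱ *
    ((1 - t / n * (q.toReal * ω))⁻¹ ^ n * ‖u - u'‖ ^ q.toReal) with hR
  -- The conditions on n sit inside the existential, so that an index `k n ≤ n` is available for
  -- every n; where they fail, 0 is used.
  have hex : ∀ n : ℕ, ∃ k ≤ n, 0 < n → t / n * (q.toReal * ω) ≤ 1 / 2 →
      MemLp ((opResolvent A (t / n))^[k] u - (opResolvent A (t / n))^[k] u' : Lp ℝ q μ) r μ ∧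
      (eLpNorm ((opResolvent A (t / n))^[k] u - (opResolvent A (t / n))^[k] u' : Lp ℝ q μ)
        r μ).toReal ≤ (R n / t) ^ (1 / σ) := by
    intro n
    by_cases h : 0 < n ∧ t / n * (q.toReal * ω) ≤ 1 / 2
    · have hn : (0 : ℝ) < n := by exact_mod_cast h.1
      obtain ⟨k, hk, h1, h2⟩ := hGN.exists_iterate_le hq hω0 hϱ hC hA
        (show 0 < t / n by positivity) (by linarith [h.2]) u u' h.1
      refine ⟨k, hk, fun _ _ => ⟨h1, ?_⟩⟩
      rw [mul_div_cancel₀ _ hn.ne', ← le_div_iff₀' ht] at h2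
      have h3 := Real.rpow_le_rpow (by positivity) h2 (inv_nonneg.2 hσ.le)
      rw [Real.rpow_rpow_inv ENNReal.toReal_nonneg hσ.ne'] at h3
      rwa [one_div σ]
    · exact ⟨0, Nat.zero_le _, fun h1 h2 => absurd ⟨h1, h2⟩ h⟩
  choose k hkn hk using hex
  have hlim := (tendsto_opSemigroup_opResolvent_iterate hA hω0 ht hu hkn).sub
    (tendsto_opSemigroup_opResolvent_iterate hA hω0 ht hu' hkn)
  have hb : Tendsto (fun n => Real.exp (ω * t) * (R n / t) ^ (1 / σ)) atTop
      (𝓝 (Real.exp (ω * t) * ((C / q.toReal * (Real.exp (ω * t) * ‖u - u'‖) ^ ϱ *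
        (Real.exp (q.toReal * ω * t) * ‖u - u'‖ ^ q.toReal)) / t) ^ (1 / σ))) := by
    refine Tendsto.const_mul _ (Tendsto.rpow_const (Tendsto.div_const (Tendsto.mul
      (Tendsto.const_mul _ (Tendsto.rpow_const
        ((tendsto_inv_one_sub_div_mul_pow t ω).mul_const _) (Or.inr hϱ)))
      ((tendsto_inv_one_sub_div_mul_pow t (q.toReal * ω)).mul_const _)) _) (Or.inr ?_))
    positivity
  have hval : Real.exp (ω * t) * ((C / q.toReal * (Real.exp (ω * t) * ‖u - u'‖) ^ ϱ *
        (Real.exp (q.toReal * ω * t) * ‖u - u'‖ ^ q.toReal)) / t) ^ (1 / σ)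
      = (C / q.toReal) ^ (1 / σ) * t ^ (-(1 / σ)) *
          Real.exp (ω * ((q.toReal + ϱ) / σ + 1) * t) * ‖u - u'‖ ^ ((q.toReal + ϱ) / σ) := by
    have e1 : C / q.toReal * (Real.exp (ω * t) * ‖u - u'‖) ^ ϱ *
        (Real.exp (q.toReal * ω * t) * ‖u - u'‖ ^ q.toReal)
        = C / q.toReal * (Real.exp (ω * t * (q.toReal + ϱ)) * ‖u - u'‖ ^ (q.toReal + ϱ)) := by
      rw [Real.mul_rpow (Real.exp_pos _).le (norm_nonneg _), ← Real.exp_mul,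
        Real.rpow_add_of_nonneg (norm_nonneg _) (by linarith) hϱ, mul_add, Real.exp_add]
      ring_nf
    rw [e1, Real.div_rpow (by positivity) ht.le, Real.mul_rpow (by positivity) (by positivity),
      Real.mul_rpow (by positivity) (by positivity), ← Real.exp_mul,
      ← Real.rpow_mul (norm_nonneg _), Real.rpow_neg ht.le, mul_one_div, mul_one_div]
    have e2 : Real.exp (ω * ((q.toReal + ϱ) / σ + 1) * t)
        = Real.exp (ω * t) * Real.exp (ω * t * (q.toReal + ϱ) / σ) := by
      rw [← Real.exp_add]
      congr 1
      ring
    rw [e2]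
    ring
  rw [hval] at hb
  refine memLp_and_eLpNorm_toReal_le_of_tendsto hlim hb ?_
  filter_upwards [eventually_div_mul_le_half t (q.toReal * ω), eventually_gt_atTop 0] with n hn hn0
  have hn' : (0 : ℝ) < n := by exact_mod_cast hn0
  have hlω : t / n * ω < 1 := by
    have : 0 ≤ t / n * ω := by positivity
    nlinarith
  obtain ⟨h1, h2⟩ := hk n hn0 hn
  have hmem : ∀ x ∈ opDomain A, (opResolvent A (t / n))^[k n] x ∈ closure (opDomain A) := by
    rintro x ⟨v, hv⟩
    obtain ⟨w, hw, -⟩ := exists_opResolvent_iterate_mem hA (show 0 < t / n by positivity) hlω hv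
      (k n)
    exact subset_closure ⟨w, hw⟩
  obtain ⟨h3, h4⟩ := hgrowth.of_nonneg (hmem u hu) (hmem u' hu')
    (show 0 ≤ ((n - k n : ℕ) : ℝ) * (t / n) by positivity) h1
  refine ⟨h3, h4.trans ?_⟩
  -- The remaining time is at most t, and ω ≥ 0, so the growth factor is at most e^{ωt}.
  have h5 : ((n - k n : ℕ) : ℝ) * (t / n) ≤ t := by
    have : ((n - k n : ℕ) : ℝ) ≤ n := by exact_mod_cast Nat.sub_le _ _
    calc ((n - k n : ℕ) : ℝ) * (t / n) ≤ n * (t / n) := by gcongr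
      _ = t := by field_simp
  gcongr

end Lebesgue

theorem mainTheorem4 {S : Type*} [MeasurableSpace S] (μ : Measure S) [SigmaFinite μ]
    (q : ℝ≥0∞) [Fact (1 ≤ q)] (hq : q ≠ ∞) (r : ℝ≥0∞) (hr : 1 ≤ r)
    (ω ϱ σ C : ℝ) (hω : 0 ≤ ω) (hϱ : 0 ≤ ϱ) (hσ : 0 < σ) (hC : 0 < C)
    (A : Set (Lp ℝ q μ × Lp ℝ q μ))
    (hA : IsMAccretive (opShift A ω))
    (hGN : GagliardoNirenbergWithDifferences A r ϱ σ ω C)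
    (hgrowth : HasExponentialGrowth A r ω)
    (γ : ℝ) (hγ : γ = (q.toReal + ϱ) / σ) :
    ∀ t : ℝ, 0 < t → ∀ u ∈ closure (opDomain A), ∀ u' ∈ closure (opDomain A),
      MemLp (opSemigroup A t u - opSemigroup A t u' : Lp ℝ q μ) r μ ∧
      (eLpNorm (opSemigroup A t u - opSemigroup A t u' : Lp ℝ q μ) r μ).toReal ≤
        (C / q.toReal) ^ (1 / σ) * t ^ (-(1 / σ)) * Real.exp (ω * (γ + 1) * t)
          * ‖u - u'‖ ^ γ := by
  intro t ht u hu u' hu'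
  have hq1 := one_le_toReal_of_fact hq
  have hγ0 : 0 ≤ γ := by rw [hγ]; positivity
  obtain ⟨x, hx, hxu⟩ := mem_closure_iff_seq_limit.1 hu
  obtain ⟨y, hy, hyu⟩ := mem_closure_iff_seq_limit.1 hu'
  have hlim : ∀ {z : ℕ → Lp ℝ q μ} {w : Lp ℝ q μ}, (∀ n, z n ∈ opDomain A) →
      w ∈ closure (opDomain A) → Tendsto z atTop (𝓝 w) →
      Tendsto (fun n => opSemigroup A t (z n)) atTop (𝓝 (opSemigroup A t w)) := by
    intro z w hz hw hzw
    rw [tendsto_iff_norm_sub_tendsto_zero] at hzw ⊢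
    have h := hzw.const_mul (Real.exp (2 * (ω * t)))
    rw [mul_zero] at h
    exact squeeze_zero (fun n => norm_nonneg _)
      (fun n => norm_opSemigroup_sub_le hA hω ht (subset_closure (hz n)) hw) h
  refine memLp_and_eLpNorm_toReal_le_of_tendsto ((hlim hx hu hxu).sub (hlim hy hu' hyu))
    (((hxu.sub hyu).norm.rpow_const (Or.inr hγ0)).const_mul _) (Eventually.of_forall fun n => ?_)
  rw [hγ]
  exact hGN.opSemigroup_of_mem_opDomain hq hω hϱ hσ hC hA hgrowth ht (hx n) (hy n)
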